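/- All graphs are finite, simple and undirected. For a graph $H$, let $\delta(H)$ denote its minimum degree. A set $D\subseteq V(H)$ is \emph{dominating} if every vertex of $V(H)\setminus D$ has at least one neighbor in $D$, and \emph{$3$-dominating} if every vertex of $V(H)\setminus D$ has at least three neighbors in $D$; $\gamma(H)$ and $\gamma_3(H)$ denote the minimum cardinality of a dominating set and of a $3$-dominating set of $H$, respectively. A connected graph $G$ is \emph{$(\gamma,\gamma_3)$-perfect} if $\delta(G)\ge 3$ and every connected induced subgraph $H$ of $G$ with $\delta(H)\ge 3$ satisfies $\gamma_3(H)=\gamma(H)+1$. For integers $r\ge 1$ and $i_1,\dots,i_r\ge 3$, let $S_3(i_1,\dots,i_r)$ be the graph obtained from the star $K_{1,r}$ with edges $e_1,\dots,e_r$ by replacing each $e_j$ with $i_j$ parallel edges, subdividing each of the resulting edges exactly once, and finally adding one new vertex that is a false twin of the center (a non-adjacent vertex with the same neighborhood as the center). Let $\mathcal{S}_3$ be the class of all graphs isomorphic to some $S_3(i_1,\dots,i_r)$ with $r\ge 1$ and $i_j\ge 3$ for every $j\in\{1,\dots,r\}$. \textbf{Theorem.} A graph $G$ is bipartite and $(\gamma,\gamma_3)$-perfect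 if and only if $G\in\mathcal{S}_3$. -/

import Mathlib

namespace PerfectDomination

/-- `D` is a dominating set of `G`: every vertex outside `D` has a neighbor in `D`. -/
def IsDominating {V : Type*} (G : SimpleGraph V) (D : Finset V) : Prop :=
  ∀ v, v ∉ D → ∃ u ∈ D, G.Adj v u

/-- `D` is a `k`-dominating set of `G`: every vertex outside `D` has at least `k` neighbors
in `D`. -/
def IsKDominating {V : Type*} (G : SimpleGraph V) (k : ℕ) (D : Finset V) : Prop :=
  ∀ v, v ∉ D → k ≤ {u | u ∈ D ∧ G.Adj v u}.ncard

/-- The domination number: the minimum cardinality of a dominating set. On a finite graph the set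
of these cardinalities is non-empty, since the whole vertex set is dominating. -/
noncomputable def dominationNumber {V : Type*} (G : SimpleGraph V) : ℕ :=
  sInf {n | ∃ D : Finset V, IsDominating G D ∧ D.card = n}

/-- The `k`-domination number: the minimum cardinality of a `k`-dominating set. -/
noncomputable def kDominationNumber {V : Type*} (G : SimpleGraph V) (k : ℕ) : ℕ :=
  sInf {n | ∃ D : Finset V, IsKDominating G k D ∧ D.card = n}

open Classical in
/-- A finite graph `G` is `(γ, γ_k)`-perfect (for `k ≥ 2`): `G` is connected, has minimum degree
at least `k`, and every connected induced subgraph `H` of minimum degree at least `k` satisfies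
`γ_k(H) = γ(H) + k - 2`. -/
def IsGammaPerfect {V : Type*} [Fintype V] (G : SimpleGraph V) (k : ℕ) : Prop :=
  G.Connected ∧ k ≤ G.minDegree ∧
    ∀ S : Set V, (G.induce S).Connected → k ≤ (G.induce S).minDegree →
      kDominationNumber (G.induce S) k = dominationNumber (G.induce S) + k - 2

/-- The vertices of `S_k(i_1, …, i_r)`: the center and the leaves of the star `K_{1,r}`, for every
`j` the `i_j` subdivision vertices of the parallel edges between the center and the `j`-th leaf,
and `k - 2` further vertices, the added twins of the center. -/
inductive StarVertex (k : ℕ) {r : ℕ} (i : Fin r → ℕ) : Type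
  | center : StarVertex k i
  | twin (t : Fin (k - 2)) : StarVertex k i
  | leaf (j : Fin r) : StarVertex k i
  | subdiv (j : Fin r) (m : Fin (i j)) : StarVertex k i

/-- The edges of `S_k(i_1, …, i_r)`, directed away from the subdivision vertices: a subdivision
vertex of the `j`-th bundle of parallel edges is joined to the center and to the `j`-th leaf (the
two ends of the subdivided edge), and to all twins of the center. -/
inductive StarEdge (k : ℕ) {r : ℕ} (i : Fin r → ℕ) : StarVertex k i → StarVertex k i → Prop
  | toCenter (j : Fin r) (m : Fin (i j)) : StarEdge k i (.subdiv j m) .center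
  | toLeaf (j : Fin r) (m : Fin (i j)) : StarEdge k i (.subdiv j m) (.leaf j)
  | toTwin (j : Fin r) (m : Fin (i j)) (t : Fin (k - 2)) : StarEdge k i (.subdiv j m) (.twin t)

/-- The graph `S_k(i_1, …, i_r)`. -/
def starGraph (k : ℕ) {r : ℕ} (i : Fin r → ℕ) : SimpleGraph (StarVertex k i) where
  Adj u v := StarEdge k i u v ∨ StarEdge k i v u
  symm := ⟨fun _ _ h => h.symm⟩
  loopless := ⟨fun _ h => by rcases h with h | h <;> cases h⟩

/-- Membership in the class `𝒮_k` (for `k ≥ 2`): `G` is isomorphic to some `S_k(i_1, …, i_r)` with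
`r ≥ 1` and all `i_j ≥ k`. -/
def InStarClass {V : Type*} (G : SimpleGraph V) (k : ℕ) : Prop :=
  ∃ (r : ℕ) (i : Fin r → ℕ), 1 ≤ r ∧ (∀ j, k ≤ i j) ∧ Nonempty (G ≃g starGraph k i)

end PerfectDomination

namespace PerfectDomination

/-! Everything rests on an exchange. Let `D` be 3-dominating with `|D| = γ + 1`. If part of `D` is
traded for vertices adjacent to all of that part and fewer than `γ` vertices remain, the result is
not dominating, so some vertex outside `D` has all its `D`-neighbors, at least three, in the removed
part. Trading three neighbors of one vertex gives `exists_of_triple`, trading two disjoint pairs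
`exists_of_pairs`. The latter forces a minimum 3-dominating set of a bipartite perfect graph to be a
side `A` (`IsSide.eq_or_eq_compl`).

Let `B` be the other side. Every triple inside the neighborhood of a vertex of `B` is then the whole
neighborhood of another vertex of `B`. Applying perfection to a subgraph in which `b₀` has lost its
twins yields a private neighbor of `b₀` (`exists_private_neighbor`). Hence all degrees in `B` are
three, and a further exchange shows that the two non-private neighbors are common to all of `B`: the
graph is `IsStarLike`, which is membership in the class, with `B` as the subdivision vertices.

Conversely, being star-like passes to induced subgraphs of minimum degree at least three, so it
suffices that `γ₃ = γ + 1` for star-like graphs: `A` is 3-dominating, every dominating set has at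
least `|A| - 1` vertices, and an exchange gives `γ < γ₃`. -/

variable {V : Type*} {G : SimpleGraph V}

/-! ### Degrees, domination numbers and isomorphism invariance -/

/-- The vertex `v` has at least three neighbors in `s`. -/
def HasThreeNeighborsIn (G : SimpleGraph V) (s : Set V) (v : V) : Prop :=
  ∃ a b c, (a ∈ s ∧ b ∈ s ∧ c ∈ s) ∧ (G.Adj v a ∧ G.Adj v b ∧ G.Adj v c) ∧
    a ≠ b ∧ a ≠ c ∧ b ≠ c

theorem three_le_ncard_iff [Finite V] (s : Set V) (v : V) :
    3 ≤ {u | u ∈ s ∧ G.Adj v u}.ncard ↔ HasThreeNeighborsIn G s v := by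
  rw [Nat.succ_le_iff, Set.two_lt_ncard_iff (Set.toFinite _)]
  simp only [HasThreeNeighborsIn, Set.mem_ofPred_eq]
  constructor <;> rintro ⟨a, b, c, h⟩ <;> exact ⟨a, b, c, by tauto⟩

theorem isKDominating_three_iff [Finite V] (D : Finset V) :
    IsKDominating G 3 D ↔ ∀ v, v ∉ D → HasThreeNeighborsIn G D v := by
  simp only [IsKDominating, ← three_le_ncard_iff, Finset.mem_coe]

theorem three_le_degree_iff [Fintype V] [DecidableRel G.Adj] (v : V) :
    3 ≤ G.degree v ↔ HasThreeNeighborsIn G Set.univ v := by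
  rw [← three_le_ncard_iff, ← G.card_neighborSet_eq_degree, ← Nat.card_eq_fintype_card]
  simp only [Set.mem_univ, true_and]
  rfl

theorem three_le_minDegree_iff [Fintype V] [Nonempty V] [DecidableRel G.Adj] :
    3 ≤ G.minDegree ↔ ∀ v, HasThreeNeighborsIn G Set.univ v := by
  simp only [← three_le_degree_iff]
  exact ⟨fun h v => h.trans (G.minDegree_le_degree v), G.le_minDegree_of_forall_le_degree 3⟩

theorem isDominating_iff_isKDominating_one [Finite V] (D : Finset V) :
    IsDominating G D ↔ IsKDominating G 1 D := by
  simp only [IsDominating, IsKDominating, Nat.one_le_iff_ne_zero, ne_eq,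
    Set.ncard_eq_zero (Set.toFinite _)]
  simp only [← ne_eq, ← Set.nonempty_iff_ne_empty]
  rfl

theorem dominationNumber_eq_kDominationNumber_one [Finite V] :
    dominationNumber G = kDominationNumber G 1 := by
  simp only [dominationNumber, kDominationNumber, isDominating_iff_isKDominating_one]

theorem kDominationNumber_le {k : ℕ} {D : Finset V} (hD : IsKDominating G k D) :
    kDominationNumber G k ≤ D.card :=
  Nat.sInf_le ⟨D, hD, rfl⟩

theorem dominationNumber_le {D : Finset V} (hD : IsDominating G D) :
    dominationNumber G ≤ D.card :=
  Nat.sInf_le ⟨D, hD, rfl⟩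

theorem exists_card_eq_kDominationNumber [Fintype V] (G : SimpleGraph V) (k : ℕ) :
    ∃ D : Finset V, IsKDominating G k D ∧ D.card = kDominationNumber G k :=
  Nat.sInf_mem (s := {n | ∃ D : Finset V, IsKDominating G k D ∧ D.card = n})
    ⟨_, Finset.univ, fun v hv => absurd (Finset.mem_univ v) hv, rfl⟩

theorem exists_card_eq_dominationNumber [Fintype V] (G : SimpleGraph V) :
    ∃ D : Finset V, IsDominating G D ∧ D.card = dominationNumber G :=
  Nat.sInf_mem (s := {n | ∃ D : Finset V, IsDominating G D ∧ D.card = n})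
    ⟨_, Finset.univ, fun v hv => absurd (Finset.mem_univ v) hv, rfl⟩

theorem IsKDominating.map {W : Type*} {H : SimpleGraph W} (e : G ≃g H) {k : ℕ} {D : Finset V}
    (hD : IsKDominating G k D) : IsKDominating H k (D.map e.toEquiv.toEmbedding) := by
  intro w hw
  have h := hD (e.symm w) fun h => hw (Finset.mem_map.2 ⟨_, h, e.apply_symm_apply w⟩)
  rw [← Set.ncard_image_of_injective _ e.injective] at h
  convert h using 2
  ext u
  simp only [Finset.mem_map, Set.mem_ofPred_eq, Set.mem_image]
  constructor
  · rintro ⟨⟨x, hx, rfl⟩, ha⟩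
    refine ⟨x, ⟨hx, ?_⟩, rfl⟩
    rw [← e.map_adj_iff, e.apply_symm_apply]
    exact ha
  · rintro ⟨x, ⟨hx, ha⟩, rfl⟩
    refine ⟨⟨x, hx, rfl⟩, ?_⟩
    rw [← e.map_adj_iff, e.apply_symm_apply] at ha
    exact ha

theorem kDominationNumber_le_of_iso [Fintype V] {W : Type*} {H : SimpleGraph W} (e : G ≃g H)
    (k : ℕ) : kDominationNumber H k ≤ kDominationNumber G k := by
  obtain ⟨D, hD, hc⟩ := exists_card_eq_kDominationNumber G k
  simpa [hc] using kDominationNumber_le (hD.map e)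

theorem kDominationNumber_congr [Fintype V] {W : Type*} [Fintype W] {H : SimpleGraph W}
    (e : G ≃g H) (k : ℕ) : kDominationNumber G k = kDominationNumber H k :=
  le_antisymm (kDominationNumber_le_of_iso e.symm k) (kDominationNumber_le_of_iso e k)

/-! ### Exchange arguments -/

open Classical in
theorem exists_of_card_exchange_lt {D P X : Finset V} (hP : ∀ p ∈ P, ∃ x ∈ X, G.Adj p x)
    (hlt : (D \ P ∪ X).card < dominationNumber G) :
    ∃ v, v ∉ D ∧ v ∉ X ∧ ∀ u ∈ D, G.Adj v u → u ∈ P := by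
  have h : ¬ IsDominating G (D \ P ∪ X) := fun h => (dominationNumber_le h).not_gt hlt
  simp only [IsDominating, not_forall, not_exists, not_and] at h
  obtain ⟨v, hv, hn⟩ := h
  simp only [Finset.mem_union, Finset.mem_sdiff, not_or, not_and, not_not] at hv
  refine ⟨v, fun hvD => ?_, hv.2, fun u hu ha => ?_⟩
  · obtain ⟨x, hx, hxa⟩ := hP v (hv.1 hvD)
    exact hn x (Finset.mem_union_right _ hx) hxa
  · by_contra hu'
    exact hn u (Finset.mem_union_left _ (Finset.mem_sdiff.2 ⟨hu, hu'⟩)) ha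

open Classical in
theorem card_exchange_le {D P X : Finset V} (hP : P ⊆ D) :
    (D \ P ∪ X).card + P.card ≤ D.card + X.card := by
  have h1 := Finset.card_union_le (D \ P) X
  have h2 := Finset.card_sdiff_add_card_eq_card hP
  omega

/-- Trade two `D`-neighbors of `x` for `x`: a vertex left undominated would have only those two
neighbors in `D`. -/
theorem dominationNumber_lt_card [Finite V] {D : Finset V} (hD : IsKDominating G 3 D) {x : V}
    (hx : x ∉ D) : dominationNumber G < D.card := by
  classical
  rw [isKDominating_three_iff] at hD
  obtain ⟨a, b, c, ⟨ha, hb, hc⟩, ⟨xa, xb, xc⟩, hab, hac, hbc⟩ := hD x hx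
  by_contra! hle
  have hcard := card_exchange_le (D := D) (P := {a, b}) (X := {x}) (by
    simp only [Finset.mem_coe] at ha hb
    intro y; simp only [Finset.mem_insert, Finset.mem_singleton]; rintro (rfl | rfl) <;> assumption)
  rw [Finset.card_pair hab, Finset.card_singleton] at hcard
  obtain ⟨v, hvD, -, hv⟩ := exists_of_card_exchange_lt (G := G) (D := D) (P := {a, b}) (X := {x})
    (by simp [xa.symm, xb.symm]) (by omega)
  obtain ⟨p, q, r, ⟨hp, hq, hr⟩, ⟨vp, vq, vr⟩, hpq, hpr, hqr⟩ := hD v hvD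
  have h1 := hv p hp vp
  have h2 := hv q hq vq
  have h3 := hv r hr vr
  simp only [Finset.mem_insert, Finset.mem_singleton] at h1 h2 h3
  grind

theorem exists_of_triple [Finite V] {D : Finset V} (hD : IsKDominating G 3 D)
    (hcard : D.card = dominationNumber G + 1) {x a b c : V} (ha : a ∈ D) (hb : b ∈ D)
    (hc : c ∈ D) (xa : G.Adj x a) (xb : G.Adj x b) (xc : G.Adj x c) (hab : a ≠ b) (hac : a ≠ c)
    (hbc : b ≠ c) :
    ∃ y, y ∉ D ∧ y ≠ x ∧ ∀ u ∈ D, G.Adj y u ↔ u = a ∨ u = b ∨ u = c := by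
  classical
  rw [isKDominating_three_iff] at hD
  have hle := card_exchange_le (D := D) (P := {a, b, c}) (X := {x}) (by
    intro y; simp only [Finset.mem_insert, Finset.mem_singleton]
    rintro (rfl | rfl | rfl) <;> assumption)
  rw [Finset.card_eq_three.2 ⟨a, b, c, hab, hac, hbc, rfl⟩, Finset.card_singleton] at hle
  obtain ⟨v, hvD, hvx, hv⟩ := exists_of_card_exchange_lt (G := G) (D := D) (P := {a, b, c})
    (X := {x}) (by simp [xa.symm, xb.symm, xc.symm]) (by omega)
  obtain ⟨p, q, r, ⟨hp, hq, hr⟩, ⟨vp, vq, vr⟩, hpq, hpr, hqr⟩ := hD v hvD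
  have h1 := hv p hp vp
  have h2 := hv q hq vq
  have h3 := hv r hr vr
  simp only [Finset.mem_insert, Finset.mem_singleton] at h1 h2 h3 hv hvx
  refine ⟨v, hvD, hvx, fun u hu => ⟨hv u hu, ?_⟩⟩
  grind

theorem exists_of_pairs {D : Finset V}
    (hcard : D.card = dominationNumber G + 1) {x a b y c d : V} (ha : a ∈ D) (hb : b ∈ D)
    (hc : c ∈ D) (hd : d ∈ D) (xa : G.Adj x a) (xb : G.Adj x b) (yc : G.Adj y c)
    (yd : G.Adj y d) (hab : a ≠ b) (hac : a ≠ c) (had : a ≠ d) (hbc : b ≠ c) (hbd : b ≠ d)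
    (hcd : c ≠ d) :
    ∃ v, v ∉ D ∧ ∀ u ∈ D, G.Adj v u → u = a ∨ u = b ∨ u = c ∨ u = d := by
  classical
  have hle := card_exchange_le (D := D) (P := {a, b, c, d}) (X := {x, y}) (by
    intro y; simp only [Finset.mem_insert, Finset.mem_singleton]
    rintro (rfl | rfl | rfl | rfl) <;> assumption)
  have h4 : ({a, b, c, d} : Finset V).card = 4 := by
    rw [Finset.card_insert_of_notMem (by simp [*]), Finset.card_insert_of_notMem (by simp [*]),
      Finset.card_pair hcd]
  -- `x = y` is allowed: only the upper bound on the number of added vertices matters.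
  have h2 := Finset.card_le_two (a := x) (b := y)
  obtain ⟨v, hvD, -, hv⟩ := exists_of_card_exchange_lt (G := G) (D := D) (P := {a, b, c, d})
    (X := {x, y}) (by simp [xa.symm, xb.symm, yc.symm, yd.symm]) (by omega)
  simp only [Finset.mem_insert, Finset.mem_singleton] at hv
  exact ⟨v, hvD, hv⟩

/-- Otherwise `d` could be erased: all its neighbors lie in `D`, and no vertex outside `D` relies on
it. -/
theorem exists_adj_notMem [Finite V] {D : Finset V} (hD : IsKDominating G 3 D)
    (hmin : D.card = kDominationNumber G 3) (hdeg : ∀ v, HasThreeNeighborsIn G Set.univ v)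
    {d : V} (hd : d ∈ D) : ∃ x, x ∉ D ∧ G.Adj d x := by
  classical
  by_contra! h
  have h3 : IsKDominating G 3 (D.erase d) := by
    rw [isKDominating_three_iff] at hD ⊢
    intro v hv
    by_cases hvd : v = d
    · subst hvd
      obtain ⟨a, b, c, -, ⟨va, vb, vc⟩, hne⟩ := hdeg v
      have key : ∀ u, G.Adj v u → u ∈ ((D.erase v : Finset V) : Set V) := fun u hu => by
        rw [Finset.mem_coe, Finset.mem_erase]
        exact ⟨hu.ne', by_contra fun hn => h u hn hu⟩
      exact ⟨a, b, c, ⟨key a va, key b vb, key c vc⟩, ⟨va, vb, vc⟩, hne⟩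
    · have hvD : v ∉ D := fun hn => hv (Finset.mem_erase.2 ⟨hvd, hn⟩)
      obtain ⟨a, b, c, ⟨ha, hb, hc⟩, ⟨va, vb, vc⟩, hne⟩ := hD v hvD
      have key : ∀ u ∈ (D : Set V), G.Adj v u → u ∈ ((D.erase d : Finset V) : Set V) :=
        fun u hu hvu => by
          rw [Finset.mem_coe, Finset.mem_erase]
          exact ⟨fun hn => h v hvD (hn ▸ hvu.symm), hu⟩
      exact ⟨a, b, c, ⟨key a ha va, key b hb vb, key c hc vc⟩, ⟨va, vb, vc⟩, hne⟩
  have h1 := kDominationNumber_le h3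
  have h2 := Finset.card_erase_lt_of_mem hd
  omega

/-! ### Minimum 3-dominating sets of bipartite graphs -/

/-- `A` is one side of a bipartition of `G`. -/
def IsSide (G : SimpleGraph V) (A : Finset V) : Prop :=
  ∀ u v, G.Adj u v → (u ∈ A ↔ v ∉ A)

theorem IsSide.compl [Fintype V] [DecidableEq V] {A : Finset V} (hA : IsSide G A) :
    IsSide G Aᶜ := by
  intro u v h
  have := hA u v h
  simp only [Finset.mem_compl]
  tauto

theorem IsSide.mem {A : Finset V} (hA : IsSide G A) {u v : V} (h : G.Adj u v) (hu : u ∉ A) :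
    v ∈ A := by
  have := hA u v h
  tauto

theorem IsSide.notMem {A : Finset V} (hA : IsSide G A) {u v : V} (h : G.Adj u v) (hu : u ∈ A) :
    v ∉ A := (hA u v h).1 hu

theorem IsSide.isKDominating [Finite V] {A : Finset V} (hA : IsSide G A)
    (hdeg : ∀ v, HasThreeNeighborsIn G Set.univ v) : IsKDominating G 3 A := by
  rw [isKDominating_three_iff]
  intro v hv
  obtain ⟨a, b, c, -, ⟨va, vb, vc⟩, hne⟩ := hdeg v
  exact ⟨a, b, c, ⟨hA.mem va hv, hA.mem vb hv, hA.mem vc hv⟩, ⟨va, vb, vc⟩, hne⟩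

theorem IsSide.eq_of_subset [Finite V] {A D : Finset V} (hA : IsSide G A)
    (hD : IsKDominating G 3 D) (h : D ⊆ A) : D = A := by
  refine h.antisymm fun v hv => ?_
  by_contra hvD
  obtain ⟨a, b, c, ⟨ha, -⟩, ⟨va, -⟩, -⟩ := (isKDominating_three_iff D).1 hD v hvD
  exact hA.notMem va hv (h ha)

/-- If `D` met both sides, each side would contain a pair in `D` with a common neighbor outside `D`.
Trading both pairs produces a vertex with three neighbors among these four vertices, hence neighbors
on both sides. -/
theorem IsSide.eq_or_eq_compl [Fintype V] [DecidableEq V] {A D : Finset V} (hA : IsSide G A)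
    (hdeg : ∀ v, HasThreeNeighborsIn G Set.univ v) (hD : IsKDominating G 3 D)
    (hmin : D.card = kDominationNumber G 3)
    (hG : kDominationNumber G 3 = dominationNumber G + 1) : D = A ∨ D = Aᶜ := by
  by_contra! hne
  have h1 : ¬ D ⊆ A := fun h => hne.1 (hA.eq_of_subset hD h)
  have h2 : ¬ D ⊆ Aᶜ := fun h => hne.2 (hA.compl.eq_of_subset hD h)
  obtain ⟨d, hd, hdA⟩ := Finset.not_subset.1 h1
  obtain ⟨e, he, heA⟩ := Finset.not_subset.1 h2
  rw [Finset.mem_compl, not_not] at heA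
  have key : ∀ w ∈ D, ∃ x ∉ D, G.Adj x w ∧ ∃ z ∈ D, G.Adj x z ∧ w ≠ z := by
    intro w hw
    obtain ⟨x, hx, hwx⟩ := exists_adj_notMem hD hmin hdeg hw
    obtain ⟨a, b, c, ⟨ha, hb, -⟩, ⟨xa, xb, -⟩, hab, -⟩ := (isKDominating_three_iff D).1 hD x hx
    by_cases hwa : w = a
    · exact ⟨x, hx, hwx.symm, b, hb, xb, hwa ▸ hab⟩
    · exact ⟨x, hx, hwx.symm, a, ha, xa, hwa⟩
  obtain ⟨x, hx, xd, d', hd', xd', hdd'⟩ := key d hd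
  obtain ⟨y, hy, ye, e', he', ye', hee'⟩ := key e he
  have hxA : x ∈ A := by_contra fun h => hdA (hA.mem xd h)
  have hyA : y ∉ A := fun h => hA.notMem ye h heA
  have hd'A : d' ∉ A := hA.notMem xd' hxA
  have he'A : e' ∈ A := hA.mem ye' hyA
  have ne : ∀ {u v : V}, u ∉ A → v ∈ A → u ≠ v := fun hu hv h => hu (h ▸ hv)
  obtain ⟨v, hv, hvn⟩ := exists_of_pairs (hmin.trans hG) hd hd' he he' xd xd' ye ye' hdd'
    (ne hdA heA) (ne hdA he'A) (ne hd'A heA) (ne hd'A he'A) hee'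
  obtain ⟨a, b, c, ⟨ha, hb, hc⟩, ⟨va, vb, vc⟩, hab, hac, hbc⟩ :=
    (isKDominating_three_iff D).1 hD v hv
  have h1 := hvn a ha va
  have h2 := hvn b hb vb
  have h3 := hvn c hc vc
  have i1 := hA v a va
  have i2 := hA v b vb
  have i3 := hA v c vc
  grind

/-- Count edges: at least three at each vertex of `A`, at most three at each vertex opposite. -/
theorem IsSide.card_le_card_compl [Fintype V] [DecidableEq V] {A : Finset V} (hA : IsSide G A)
    (hdeg : ∀ v, HasThreeNeighborsIn G Set.univ v)
    (h3 : ∀ b, b ∉ A → ∃ x y z, G.neighborSet b = {x, y, z}) : A.card ≤ Aᶜ.card := by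
  classical
  have h := Finset.card_mul_le_card_mul (m := 3) (n := 3) (s := A) (t := Aᶜ) G.Adj
    (fun a ha => ?_) (fun b hb => ?_)
  · omega
  · obtain ⟨x, y, z, -, ⟨ax, ay, az⟩, hne⟩ := hdeg a
    have : 2 < (Finset.bipartiteAbove G.Adj Aᶜ a).card := by
      rw [Finset.two_lt_card_iff]
      refine ⟨x, y, z, ?_, ?_, ?_, hne⟩ <;>
        simp only [Finset.mem_bipartiteAbove, Finset.mem_compl]
      exacts [⟨hA.notMem ax ha, ax⟩, ⟨hA.notMem ay ha, ay⟩, ⟨hA.notMem az ha, az⟩]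
    omega
  · obtain ⟨x, y, z, hb'⟩ := h3 b (Finset.mem_compl.1 hb)
    refine (Finset.card_le_card (t := {x, y, z}) fun a ha => ?_).trans Finset.card_le_three
    have : a ∈ G.neighborSet b := (Finset.mem_bipartiteBelow _ |>.1 ha).2.symm
    rw [hb'] at this
    simpa using this

/-- By the edge count `A` is the smaller side, so it attains `γ₃`, and the triple exchange applies
to the whole neighborhood of `b`. -/
theorem IsSide.exists_same_neighborSet [Fintype V] {A : Finset V} (hA : IsSide G A)
    (hdeg : ∀ v, HasThreeNeighborsIn G Set.univ v)
    (h3 : ∀ b, b ∉ A → ∃ x y z, G.neighborSet b = {x, y, z})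
    (hG : kDominationNumber G 3 = dominationNumber G + 1) {b : V} (hb : b ∉ A) :
    ∃ b', b' ∉ A ∧ b' ≠ b ∧ G.neighborSet b' = G.neighborSet b := by
  classical
  have hA3 := hA.isKDominating hdeg
  have hcard : A.card = kDominationNumber G 3 := by
    obtain ⟨D, hD, hDc⟩ := exists_card_eq_kDominationNumber G 3
    have h1 := kDominationNumber_le hA3
    have h2 := hA.card_le_card_compl hdeg h3
    rcases hA.eq_or_eq_compl hdeg hD hDc hG with rfl | rfl
    · exact hDc
    · omega
  obtain ⟨x, y, z, ⟨hx, hy, hz⟩, ⟨bx, by', bz⟩, hxy, hxz, hyz⟩ :=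
    (isKDominating_three_iff A).1 hA3 b hb
  obtain ⟨p, q, r, hbn⟩ := h3 b hb
  obtain ⟨b', hb'A, hne, hb'⟩ := exists_of_triple hA3 (hcard.trans hG) hx hy hz bx by' bz hxy hxz hyz
  refine ⟨b', hb'A, hne, ?_⟩
  have e1 : ∀ u, G.Adj b u ↔ u = p ∨ u = q ∨ u = r := fun u => by
    rw [← G.mem_neighborSet, hbn]; simp
  ext u
  rw [G.mem_neighborSet, G.mem_neighborSet]
  have e2 : G.Adj b' u → u ∈ A := fun h => hA.mem h hb'A
  have e3 := hb' u
  have e4 := (e1 x).1 bx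
  have e5 := (e1 y).1 by'
  have e6 := (e1 z).1 bz
  have e7 : G.Adj b u → u ∈ A := fun h => hA.mem h hb
  have e8 := e1 u
  grind

/-! ### Perfection applied to induced subgraphs -/

theorem hasThreeNeighborsIn_induce_iff {S : Set V} {v : V} (hv : v ∈ S) :
    HasThreeNeighborsIn (G.induce S) Set.univ ⟨v, hv⟩ ↔ HasThreeNeighborsIn G S v := by
  constructor
  · rintro ⟨⟨a, ha⟩, ⟨b, hb⟩, ⟨c, hc⟩, -, hadj, hne⟩
    exact ⟨a, b, c, ⟨ha, hb, hc⟩, hadj, by simpa using hne⟩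
  · rintro ⟨a, b, c, ⟨ha, hb, hc⟩, hadj, hne⟩
    exact ⟨⟨a, ha⟩, ⟨b, hb⟩, ⟨c, hc⟩, ⟨trivial, trivial, trivial⟩, hadj, by simpa using hne⟩

theorem IsGammaPerfect.induce_eq [Fintype V] (hG : IsGammaPerfect G 3) {S : Set V}
    (hS : (G.induce S).Connected) (hdeg : ∀ v ∈ S, HasThreeNeighborsIn G S v) :
    kDominationNumber (G.induce S) 3 = dominationNumber (G.induce S) + 1 := by
  classical
  have := hS.nonempty
  have h := hG.2.2 S hS ?_
  · omega
  · have h := (three_le_minDegree_iff (G := G.induce S)).2 fun v =>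
      (hasThreeNeighborsIn_induce_iff v.2).2 (hdeg v v.2)
    convert h

theorem IsGammaPerfect.hasThreeNeighborsIn [Fintype V] (hG : IsGammaPerfect G 3) (v : V) :
    HasThreeNeighborsIn G Set.univ v := by
  classical
  have : Nonempty V := ⟨v⟩
  exact three_le_minDegree_iff.1 hG.2.1 v

theorem IsGammaPerfect.eq [Fintype V] (hG : IsGammaPerfect G 3) :
    kDominationNumber G 3 = dominationNumber G + 1 := by
  classical
  have e : G.induce Set.univ ≃g G := SimpleGraph.induceUnivIso G
  have h := hG.induce_eq (S := Set.univ) (e.connected_iff.2 hG.1)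
    fun v _ => hG.hasThreeNeighborsIn v
  rw [dominationNumber_eq_kDominationNumber_one] at h ⊢
  rwa [kDominationNumber_congr e, kDominationNumber_congr e] at h

theorem exists_isSide_of_isGammaPerfect [Fintype V] (hb : G.IsBipartite)
    (hG : IsGammaPerfect G 3) :
    ∃ A : Finset V, IsSide G A ∧ IsKDominating G 3 A ∧ A.card = dominationNumber G + 1 := by
  classical
  obtain ⟨f⟩ := hb
  have hA : IsSide G (Finset.univ.filter fun v => f v = 0) := by
    intro u v h
    have := f.valid h
    simp only [Finset.mem_filter, Finset.mem_univ, true_and]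
    change f u ≠ f v at this
    omega
  obtain ⟨D, hD, hDc⟩ := exists_card_eq_kDominationNumber G 3
  refine ⟨D, ?_, hD, hDc.trans hG.eq⟩
  rcases hA.eq_or_eq_compl hG.hasThreeNeighborsIn hD hDc hG.eq with rfl | rfl
  exacts [hA, hA.compl]

/-! ### The pruned subgraph and private neighbors -/

/-- The side `A` of `G`, a vertex `b₀` on the other side, and all vertices on the other side that
have exactly three neighbors and a neighborhood different from that of `b₀`. -/
def pruned (G : SimpleGraph V) (A : Finset V) (b₀ : V) : Set V :=
  {v | v ∈ A ∨ v = b₀ ∨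
    (v ∉ A ∧ (∃ x y z, G.neighborSet v = {x, y, z}) ∧ G.neighborSet v ≠ G.neighborSet b₀)}

/-- A triple of neighbors of `b` containing `a` and `a'` is, by `htriple`, the neighborhood of some
vertex. That vertex survives pruning unless it is a twin of `b₀`, and then `b₀` serves instead. -/
theorem exists_mem_pruned_adj {A : Finset V} (hdeg : ∀ v, HasThreeNeighborsIn G Set.univ v)
    (htriple : ∀ b, b ∉ A → ∀ x y z, G.Adj b x → G.Adj b y → G.Adj b z → x ≠ y → x ≠ z → y ≠ z →
      ∃ b', b' ∉ A ∧ b' ≠ b ∧ G.neighborSet b' = {x, y, z})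
    {b₀ : V} (h₀ : b₀ ∉ A) (h₀' : ∃ x y z, G.neighborSet b₀ = {x, y, z})
    {b a a' : V} (hb : b ∉ A) (ha : G.Adj b a) (ha' : G.Adj b a') :
    ∃ v ∈ pruned G A b₀, v ∉ A ∧ G.Adj v a ∧ G.Adj v a' := by
  have key : ∃ b', b' ∉ A ∧ (∃ x y z, G.neighborSet b' = {x, y, z}) ∧ G.Adj b' a ∧ G.Adj b' a' := by
    obtain ⟨p, q, r, -, ⟨hp, hq, hr⟩, hpq, hpr, hqr⟩ := hdeg b
    have key : ∃ x y z, (G.Adj b x ∧ G.Adj b y ∧ G.Adj b z) ∧ (x ≠ y ∧ x ≠ z ∧ y ≠ z) ∧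
        (a = x ∨ a = y) ∧ (a' = x ∨ a' = y) := by
      by_cases haa : a = a'
      · subst haa
        by_cases h : p = a
        · subst h
          exact ⟨p, q, r, ⟨ha, hq, hr⟩, ⟨hpq, hpr, hqr⟩, .inl rfl, .inl rfl⟩
        · by_cases h' : q = a
          · subst h'
            exact ⟨q, p, r, ⟨ha, hp, hr⟩, ⟨hpq.symm, hqr, hpr⟩, .inl rfl, .inl rfl⟩
          · exact ⟨a, p, q, ⟨ha, hp, hq⟩, ⟨Ne.symm h, Ne.symm h', hpq⟩, .inl rfl, .inl rfl⟩
      · have : ∃ z, G.Adj b z ∧ a ≠ z ∧ a' ≠ z := by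
          by_contra! h
          have h1 := h p hp
          have h2 := h q hq
          have h3 := h r hr
          clear htriple hdeg h
          by_cases a = p <;> by_cases a = q <;> grind
        obtain ⟨z, hz, h1, h2⟩ := this
        exact ⟨a, a', z, ⟨ha, ha', hz⟩, ⟨haa, h1, h2⟩, .inl rfl, .inr rfl⟩
    obtain ⟨x, y, z, ⟨hx, hy, hz⟩, ⟨hxy, hxz, hyz⟩, h1, h2⟩ := key
    obtain ⟨b', hb'A, -, hb'⟩ := htriple b hb x y z hx hy hz hxy hxz hyz
    have e : ∀ u, G.Adj b' u ↔ u = x ∨ u = y ∨ u = z := fun u => by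
      rw [← G.mem_neighborSet, hb']; simp
    refine ⟨b', hb'A, ⟨x, y, z, hb'⟩, (e a).2 ?_, (e a').2 ?_⟩ <;> tauto
  obtain ⟨b', hb'A, h3, ha, ha'⟩ := key
  by_cases h : G.neighborSet b' = G.neighborSet b₀
  · refine ⟨b₀, .inr (.inl rfl), h₀, ?_, ?_⟩ <;> rwa [← G.mem_neighborSet, ← h]
  · exact ⟨b', .inr (.inr ⟨hb'A, h3, h⟩), hb'A, ha, ha'⟩

section

variable {A : Finset V} (hA : IsSide G A)
  (hdeg : ∀ v, HasThreeNeighborsIn G Set.univ v)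
  (htriple : ∀ b, b ∉ A → ∀ x y z, G.Adj b x → G.Adj b y → G.Adj b z → x ≠ y → x ≠ z → y ≠ z →
    ∃ b', b' ∉ A ∧ b' ≠ b ∧ G.neighborSet b' = {x, y, z})

include hA hdeg htriple

/-- Pruning keeps all of `A`, and vertices of `A` with a common neighbor retain one, so a walk of
`G` can be followed along its vertices in `A`. -/
theorem pruned_connected (hconn : G.Connected) {b₀ : V} (h₀ : b₀ ∉ A)
    (h₀' : ∃ x y z, G.neighborSet b₀ = {x, y, z}) : (G.induce (pruned G A b₀)).Connected := by
  have hAS : ∀ a ∈ A, a ∈ pruned G A b₀ := fun a ha => .inl ha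
  have hstep : ∀ b ∉ A, ∀ a (ha : a ∈ A) a' (ha' : a' ∈ A), G.Adj b a → G.Adj b a' →
      (G.induce (pruned G A b₀)).Reachable ⟨a, hAS a ha⟩ ⟨a', hAS a' ha'⟩ := by
    intro b hb a ha a' ha' h h'
    obtain ⟨v, hv, -, hva, hva'⟩ := exists_mem_pruned_adj hdeg htriple h₀ h₀' hb h h'
    have h1 : (G.induce (pruned G A b₀)).Adj ⟨a, hAS a ha⟩ ⟨v, hv⟩ := hva.symm
    have h2 : (G.induce (pruned G A b₀)).Adj ⟨v, hv⟩ ⟨a', hAS a' ha'⟩ := hva'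
    exact h1.reachable.trans h2.reachable
  -- The second conjunct carries the induction through prefixes that end outside `A`.
  have hwalk : ∀ u v (_ : G.Walk u v) (hu : u ∈ A),
      (∀ hv : v ∈ A, (G.induce (pruned G A b₀)).Reachable ⟨u, hAS u hu⟩ ⟨v, hAS v hv⟩) ∧
      (v ∉ A → ∀ w (hw : w ∈ A), G.Adj v w →
        (G.induce (pruned G A b₀)).Reachable ⟨u, hAS u hu⟩ ⟨w, hAS w hw⟩) := by
    intro u v p hu
    induction p using SimpleGraph.Walk.concatRec with
    | Hnil => exact ⟨fun _ => .refl _, fun h => absurd hu h⟩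
    | @Hconcat u v w p h ih =>
      obtain ⟨i1, i2⟩ := ih hu
      refine ⟨fun hw => i2 (hA.notMem h.symm hw) w hw h, fun hw x hx hwx => ?_⟩
      have hv := hA.mem h.symm hw
      exact (i1 hv).trans (hstep w hw v hv x hx h.symm hwx)
  have hAA : ∀ u (hu : u ∈ A) v (hv : v ∈ A),
      (G.induce (pruned G A b₀)).Reachable ⟨u, hAS u hu⟩ ⟨v, hAS v hv⟩ := fun u hu v hv =>
    let ⟨p⟩ := hconn.preconnected u v
    (hwalk u v p hu).1 hv
  have hrep : ∀ v : pruned G A b₀, ∃ a, ∃ ha : a ∈ A,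
      (G.induce (pruned G A b₀)).Reachable v ⟨a, hAS a ha⟩ := by
    rintro ⟨v, hv⟩
    by_cases hvA : v ∈ A
    · exact ⟨v, hvA, .refl _⟩
    · obtain ⟨a, -, -, -, ⟨ha, -⟩, -⟩ := hdeg v
      have haA := hA.mem ha hvA
      have h : (G.induce (pruned G A b₀)).Adj ⟨v, hv⟩ ⟨a, hAS a haA⟩ := ha
      exact ⟨a, haA, h.reachable⟩
  rw [SimpleGraph.connected_iff]
  refine ⟨fun u v => ?_, ⟨b₀, .inr (.inl rfl)⟩⟩
  obtain ⟨a, ha, h1⟩ := hrep u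
  obtain ⟨a', ha', h2⟩ := hrep v
  exact (h1.trans (hAA a ha a' ha')).trans h2.symm

/-- Only `v ∈ A` can lose neighbors. If `v` is adjacent to `b₀`, then `b₀`, the vertex from `hcov`
and a twin of the latter remain. Otherwise, a neighbor of degree at least four has three triples of
neighbors through `v`, which give three surviving vertices; without such a neighbor, all neighbors
of `v` survive. -/
theorem pruned_hasThreeNeighborsIn {b₀ : V}
    (hcov : ∀ t, G.Adj b₀ t → ∃ b, b ∉ A ∧ (∃ x y z, G.neighborSet b = {x, y, z}) ∧ G.Adj b t ∧
      G.neighborSet b ≠ G.neighborSet b₀) (v : V) :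
    HasThreeNeighborsIn G (pruned G A b₀) v := by
  by_cases hvA : v ∈ A
  swap
  · obtain ⟨a, b, c, -, ⟨ha, hb, hc⟩, hne⟩ := hdeg v
    exact ⟨a, b, c, ⟨.inl (hA.mem ha hvA), .inl (hA.mem hb hvA), .inl (hA.mem hc hvA)⟩,
      ⟨ha, hb, hc⟩, hne⟩
  by_cases h0v : G.Adj b₀ v
  · obtain ⟨b, hb, ⟨x, y, z, hxyz⟩, hbv, hne⟩ := hcov v h0v
    have e : ∀ u, G.Adj b u ↔ u = x ∨ u = y ∨ u = z := fun u => by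
      rw [← G.mem_neighborSet, hxyz]; simp
    have hd : x ≠ y ∧ x ≠ z ∧ y ≠ z := by
      obtain ⟨p, q, r, -, ⟨hp, hq, hr⟩, hpq, hpr, hqr⟩ := hdeg b
      rw [e] at hp hq hr
      grind
    obtain ⟨b', hb', hbb', hb'n⟩ := htriple b hb x y z (by simp [e]) (by simp [e]) (by simp [e])
      hd.1 hd.2.1 hd.2.2
    have hb'v : G.Adj b' v := by rwa [← G.mem_neighborSet, hb'n, ← hxyz]
    refine ⟨b₀, b, b', ⟨.inr (.inl rfl), .inr (.inr ⟨hb, ⟨x, y, z, hxyz⟩, hne⟩),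
      .inr (.inr ⟨hb', ⟨x, y, z, hb'n⟩, ?_⟩)⟩, ⟨h0v.symm, hbv.symm, hb'v.symm⟩, ?_, ?_, hbb'.symm⟩
    · rwa [hb'n, ← hxyz]
    · rintro rfl; exact hne rfl
    · rintro rfl; exact hne (hxyz.trans hb'n.symm)
  · have hmem : ∀ b, b ∉ A → G.Adj b v → (∃ x y z, G.neighborSet b = {x, y, z}) →
        b ∈ pruned G A b₀ := fun b hb hbv h3 =>
      .inr (.inr ⟨hb, h3, fun h => h0v (by rwa [← G.mem_neighborSet, ← h])⟩)
    by_cases hbig : ∃ b p q r, b ∉ A ∧ G.Adj b v ∧ (G.Adj b p ∧ G.Adj b q ∧ G.Adj b r) ∧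
        (v ≠ p ∧ v ≠ q ∧ v ≠ r) ∧ p ≠ q ∧ p ≠ r ∧ q ≠ r
    · obtain ⟨b, p, q, r, hb, hbv, ⟨hp, hq, hr⟩, ⟨vp, vq, vr⟩, hpq, hpr, hqr⟩ := hbig
      obtain ⟨b₁, hb₁, -, hn₁⟩ := htriple b hb v p q hbv hp hq vp vq hpq
      obtain ⟨b₂, hb₂, -, hn₂⟩ := htriple b hb v p r hbv hp hr vp vr hpr
      obtain ⟨b₃, hb₃, -, hn₃⟩ := htriple b hb v q r hbv hq hr vq vr hqr
      have a₁ : G.Adj b₁ v := by rw [← G.mem_neighborSet, hn₁]; simp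
      have a₂ : G.Adj b₂ v := by rw [← G.mem_neighborSet, hn₂]; simp
      have a₃ : G.Adj b₃ v := by rw [← G.mem_neighborSet, hn₃]; simp
      refine ⟨b₁, b₂, b₃, ⟨hmem b₁ hb₁ a₁ ⟨_, _, _, hn₁⟩, hmem b₂ hb₂ a₂ ⟨_, _, _, hn₂⟩,
        hmem b₃ hb₃ a₃ ⟨_, _, _, hn₃⟩⟩, ⟨a₁.symm, a₂.symm, a₃.symm⟩, ?_, ?_, ?_⟩
      · rintro rfl
        have : q ∈ ({v, p, r} : Set V) := by rw [← hn₂, hn₁]; simp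
        simp at this; grind
      · rintro rfl
        have : p ∈ ({v, q, r} : Set V) := by rw [← hn₃, hn₁]; simp
        simp at this; grind
      · rintro rfl
        have : p ∈ ({v, q, r} : Set V) := by rw [← hn₃, hn₂]; simp
        simp at this; grind
    · have h3 : ∀ b, b ∉ A → G.Adj b v → ∃ x y z, G.neighborSet b = {x, y, z} := by
        intro b hb hbv
        obtain ⟨p, q, r, -, ⟨hp, hq, hr⟩, hpq, hpr, hqr⟩ := hdeg b
        refine ⟨p, q, r, Set.ext fun u => ?_⟩
        simp only [SimpleGraph.mem_neighborSet, Set.mem_insert_iff, Set.mem_singleton_iff]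
        have : ¬ (v ≠ p ∧ v ≠ q ∧ v ≠ r) := fun h =>
          hbig ⟨b, p, q, r, hb, hbv, ⟨hp, hq, hr⟩, h, hpq, hpr, hqr⟩
        constructor
        · intro hu
          by_contra hn
          apply hbig
          by_cases h1 : v = p
          · exact ⟨b, q, r, u, hb, hbv, ⟨hq, hr, hu⟩, by grind⟩
          · by_cases h2 : v = q
            · exact ⟨b, p, r, u, hb, hbv, ⟨hp, hr, hu⟩, by grind⟩
            · exact ⟨b, p, q, u, hb, hbv, ⟨hp, hq, hu⟩, by grind⟩
        · rintro (rfl | rfl | rfl) <;> assumption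
      obtain ⟨a, b, c, -, ⟨ha, hb, hc⟩, hne⟩ := hdeg v
      have key : ∀ b, G.Adj v b → b ∈ pruned G A b₀ := fun b hb =>
        hmem b (hA.notMem hb hvA) hb.symm (h3 b (hA.notMem hb hvA) hb.symm)
      exact ⟨a, b, c, ⟨key a ha, key b hb, key c hc⟩, ⟨ha, hb, hc⟩, hne⟩

/-- Otherwise the pruned subgraph is connected with minimum degree at least three, and all its
degrees opposite `A` are three. Perfection then demands a twin of `b₀` there, but pruning has
removed them all. -/
theorem exists_private_neighbor [Fintype V] (hG : IsGammaPerfect G 3) {b₀ : V} (h₀ : b₀ ∉ A)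
    (h₀' : ∃ x y z, G.neighborSet b₀ = {x, y, z}) :
    ∃ t, G.Adj b₀ t ∧ ∀ b, b ∉ A → (∃ x y z, G.neighborSet b = {x, y, z}) → G.Adj b t →
      G.neighborSet b = G.neighborSet b₀ := by
  classical
  by_contra! hcov
  have hdegS := pruned_hasThreeNeighborsIn hA hdeg htriple hcov
  have hS := hG.induce_eq (pruned_connected hA hdeg htriple hG.1 h₀ h₀') fun v _ => hdegS v
  have hAS : ∀ a ∈ A, a ∈ pruned G A b₀ := fun a ha => .inl ha
  have hside : IsSide (G.induce (pruned G A b₀)) (Finset.univ.filter fun v => v.1 ∈ A) := by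
    intro u v h
    simpa using hA u v h
  obtain ⟨⟨b, hbS⟩, hbA, hne, hb⟩ := hside.exists_same_neighborSet
    (fun v => (hasThreeNeighborsIn_induce_iff v.2).2 (hdegS v)) (by
      rintro ⟨b, hbS⟩ hbA
      simp only [Finset.mem_filter, Finset.mem_univ, true_and] at hbA
      have : ∃ x y z, G.neighborSet b = {x, y, z} := by
        rcases hbS with h | rfl | h
        exacts [absurd h hbA, h₀', h.2.1]
      obtain ⟨x, y, z, hb⟩ := this
      have e : ∀ u, G.Adj b u ↔ u = x ∨ u = y ∨ u = z := fun u => by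
        rw [← G.mem_neighborSet, hb]; simp
      refine ⟨⟨x, hAS x (hA.mem ((e x).2 (by simp)) hbA)⟩,
        ⟨y, hAS y (hA.mem ((e y).2 (by simp)) hbA)⟩,
        ⟨z, hAS z (hA.mem ((e z).2 (by simp)) hbA)⟩, Set.ext fun ⟨u, hu⟩ => ?_⟩
      simpa [Subtype.ext_iff] using e u) hS (b := ⟨b₀, .inr (.inl rfl)⟩) (by simpa using h₀)
  simp only [Finset.mem_filter, Finset.mem_univ, true_and] at hbA
  have hbS' := hbS
  rcases hbS' with h | rfl | ⟨-, -, h⟩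
  · exact hbA h
  · exact hne rfl
  · refine h (Set.ext fun u => ?_)
    have key : ∀ hu : u ∈ pruned G A b₀, G.Adj b u ↔ G.Adj b₀ u := fun hu => by
      have := Set.ext_iff.1 hb ⟨u, hu⟩
      simpa using this
    exact ⟨fun hu => (key (.inl (hA.mem hu hbA))).1 hu, fun hu => (key (.inl (hA.mem hu h₀))).2 hu⟩

/-- Given a fourth neighbor `s`, some `b₀` has neighborhood `{p, q, r}` and a private neighbor `t`
in it. But a triple through `t` and `s` is also a neighborhood, different from that of `b₀`. -/
theorem exists_neighborSet_eq_triple [Fintype V] (hG : IsGammaPerfect G 3) {b : V} (hb : b ∉ A) :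
    ∃ x y z, G.neighborSet b = {x, y, z} := by
  obtain ⟨p, q, r, -, ⟨hp, hq, hr⟩, hpq, hpr, hqr⟩ := hdeg b
  by_cases h : ∃ s, G.Adj b s ∧ s ≠ p ∧ s ≠ q ∧ s ≠ r
  · exfalso
    obtain ⟨s, hs, hsp, hsq, hsr⟩ := h
    obtain ⟨b₀, hb₀, -, hn₀⟩ := htriple b hb p q r hp hq hr hpq hpr hqr
    obtain ⟨t, ht, htn⟩ := exists_private_neighbor hA hdeg htriple hG hb₀ ⟨_, _, _, hn₀⟩
    have hs₀ : s ∉ G.neighborSet b₀ := by rw [hn₀]; simp [hsp, hsq, hsr]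
    have key : ∀ x y, G.Adj b x → G.Adj b y → x ≠ y → s ≠ x → s ≠ y → t = x ∨ t = y → False := by
      intro x y hx hy hxy hsx hsy hxt
      obtain ⟨b', hb', -, hn⟩ := htriple b hb x y s hx hy hs hxy hsx.symm hsy.symm
      have h1 := htn b' hb' ⟨_, _, _, hn⟩ (by
        rw [← G.mem_neighborSet, hn]; rcases hxt with rfl | rfl <;> simp)
      apply hs₀
      rw [← h1, hn]; simp
    rw [← G.mem_neighborSet, hn₀] at ht
    rcases ht with h | h | h
    · exact key p q hp hq hpq hsp hsq (.inl h)
    · exact key p q hp hq hpq hsp hsq (.inr h)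
    · exact key p r hp hr hpr hsp hsr (.inr h)
  · push Not at h
    refine ⟨p, q, r, Set.ext fun u => ⟨fun hu => ?_, ?_⟩⟩
    · have := h u hu
      simp only [Set.mem_insert_iff, Set.mem_singleton_iff]
      tauto
    · rintro (rfl | rfl | rfl) <;> assumption

end

/-! ### Bipartite perfect graphs are star-like -/

/-- `c` and `c'` are distinct vertices on the side `A` of the bipartite graph `G`, and each vertex
on the other side is adjacent to exactly `c`, `c'` and one further vertex. -/
structure IsStarLike (G : SimpleGraph V) (A : Finset V) (c c' : V) : Prop where
  isSide : IsSide G A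
  hasThree : ∀ v, HasThreeNeighborsIn G Set.univ v
  center_mem : c ∈ A
  twin_mem : c' ∈ A
  center_ne_twin : c ≠ c'
  neighborSet_eq : ∀ b, b ∉ A → ∃ l, l ≠ c ∧ l ≠ c' ∧ G.neighborSet b = {c, c', l}

/-- Suppose `b` is not adjacent to `c`. For `x` either of `p`, `q`, trade `{l₀, c}` and `{l, x}` for
`b₀` and `b`. The resulting `v` has three neighbors among these four, so it sees `l₀` or `l` and is
a twin of `b₀` or `b`. A twin of `b` would have both `p` and `q` as neighbors, which is impossible;
a twin of `b₀` has neighbor `c'`, which forces `c' = x`. Both choices of `x` give `p = q`. -/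
theorem adj_of_private_neighbors {A : Finset V}
    (hcard : A.card = dominationNumber G + 1) (hA : IsSide G A)
    (hdeg : ∀ v, HasThreeNeighborsIn G Set.univ v)
    {b₀ b l₀ l c c' p q : V} (hb₀ : b₀ ∉ A) (hb : b ∉ A)
    (hn₀ : G.neighborSet b₀ = {l₀, c, c'}) (hn : G.neighborSet b = {l, p, q})
    (hl₀ : ∀ v, v ∉ A → G.Adj v l₀ → G.neighborSet v = G.neighborSet b₀)
    (hl : ∀ v, v ∉ A → G.Adj v l → G.neighborSet v = G.neighborSet b) : G.Adj b c := by
  have dist : ∀ v x y z, G.neighborSet v = {x, y, z} →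
      (∀ u, G.Adj v u ↔ u = x ∨ u = y ∨ u = z) ∧ x ≠ y ∧ x ≠ z ∧ y ≠ z := by
    intro v x y z h
    have e : ∀ u, G.Adj v u ↔ u = x ∨ u = y ∨ u = z := fun u => by
      rw [← G.mem_neighborSet, h]; simp
    refine ⟨e, ?_⟩
    obtain ⟨p, q, r, -, ⟨hp, hq, hr⟩, hpq, hpr, hqr⟩ := hdeg v
    rw [e] at hp hq hr
    grind
  obtain ⟨e₀, h1, h2, h3⟩ := dist b₀ l₀ c c' hn₀
  obtain ⟨e, h4, h5, h6⟩ := dist b l p q hn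
  by_contra hbc
  have hne : G.neighborSet b ≠ G.neighborSet b₀ := fun h => hbc (by
    rw [← G.mem_neighborSet, h, G.mem_neighborSet, e₀]; simp)
  have hbl₀ : ¬ G.Adj b l₀ := fun h => hne (hl₀ b hb h)
  have hb₀l : ¬ G.Adj b₀ l := fun h => hne (hl b₀ hb₀ h).symm
  have mem₀ : ∀ u, G.Adj b₀ u → u ∈ A := fun u h => hA.mem h hb₀
  have mem : ∀ u, G.Adj b u → u ∈ A := fun u h => hA.mem h hb
  have key : ∀ x, x = p ∨ x = q → c' = x := by
    intro x hx
    have hbx : G.Adj b x := by rw [e]; tauto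
    have hbl : G.Adj b l := by simp [e]
    have hb₀c : G.Adj b₀ c := by simp [e₀]
    have hb₀l₀ : G.Adj b₀ l₀ := by simp [e₀]
    obtain ⟨v, hv, hvn⟩ := exists_of_pairs hcard (mem₀ _ hb₀l₀) (mem₀ _ hb₀c) (mem _ hbl)
      (mem _ hbx) hb₀l₀ hb₀c hbl hbx h1 (fun h => hbl₀ (h ▸ hbl)) (fun h => hbl₀ (h ▸ hbx))
      (fun h => hbc (h ▸ hbl)) (fun h => hbc (h ▸ hbx)) (by rcases hx with rfl | rfl <;> assumption)
    have hvn : ∀ u, G.Adj v u → u = l₀ ∨ u = c ∨ u = l ∨ u = x := fun u h => hvn u (hA.mem h hv) h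
    have hcase : G.Adj v l₀ ∨ G.Adj v l := by
      obtain ⟨p, q, r, -, ⟨hp, hq, hr⟩, hpq, hpr, hqr⟩ := hdeg v
      have i1 := hvn p hp
      have i2 := hvn q hq
      have i3 := hvn r hr
      grind
    rcases hcase with h | h
    · have hvc : G.Adj v c' := by
        rw [← G.mem_neighborSet, hl₀ v hv h, G.mem_neighborSet, e₀]; simp
      have := hvn c' hvc
      have hc'l : c' ≠ l := fun h => hb₀l (by rw [← h, e₀]; simp)
      grind
    · have hvp : ∀ u, G.Adj b u → G.Adj v u := fun u hu => by
        rw [← G.mem_neighborSet, hl v hv h]; exact hu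
      have i1 := hvn p (hvp p (by simp [e]))
      have i2 := hvn q (hvp q (by simp [e]))
      have i3 : G.Adj b p := by simp [e]
      have i4 : G.Adj b q := by simp [e]
      grind
  exact h6 ((key p (.inl rfl)).symm.trans (key q (.inr rfl)))

theorem exists_isStarLike [Fintype V] (hb : G.IsBipartite) (hG : IsGammaPerfect G 3) :
    ∃ A c c', IsStarLike G A c c' := by
  classical
  obtain ⟨A, hA, hA3, hcard⟩ := exists_isSide_of_isGammaPerfect hb hG
  have hdeg := hG.hasThreeNeighborsIn
  have htriple : ∀ b, b ∉ A → ∀ x y z, G.Adj b x → G.Adj b y → G.Adj b z → x ≠ y → x ≠ z →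
      y ≠ z → ∃ b', b' ∉ A ∧ b' ≠ b ∧ G.neighborSet b' = {x, y, z} := by
    intro b hb x y z bx by' bz hxy hxz hyz
    have hx := hA.mem bx hb
    have hy := hA.mem by' hb
    have hz := hA.mem bz hb
    obtain ⟨b', hb', hne, h⟩ := exists_of_triple hA3 hcard hx hy hz bx by' bz hxy hxz hyz
    refine ⟨b', hb', hne, Set.ext fun u => ?_⟩
    simp only [SimpleGraph.mem_neighborSet, Set.mem_insert_iff, Set.mem_singleton_iff]
    refine ⟨fun hu => (h u (hA.mem hu hb')).1 hu, fun hu => (h u ?_).2 hu⟩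
    rcases hu with rfl | rfl | rfl <;> assumption
  have h3 := fun b (hb : b ∉ A) => exists_neighborSet_eq_triple hA hdeg htriple hG hb
  have hpriv : ∀ b, b ∉ A → ∃ l p q, G.neighborSet b = {l, p, q} ∧
      ∀ v, v ∉ A → G.Adj v l → G.neighborSet v = G.neighborSet b := by
    intro b hb
    obtain ⟨x, y, z, hn⟩ := h3 b hb
    obtain ⟨t, ht, htn⟩ := exists_private_neighbor hA hdeg htriple hG hb ⟨x, y, z, hn⟩
    have htn' := fun v (hv : v ∉ A) h => htn v hv (h3 v hv) h
    rw [← G.mem_neighborSet, hn] at ht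
    rcases ht with rfl | rfl | rfl
    · exact ⟨t, y, z, hn, htn'⟩
    · exact ⟨t, x, z, by rw [hn, Set.insert_comm], htn'⟩
    · exact ⟨t, x, y, by rw [hn, Set.insert_comm t x, Set.pair_comm t y], htn'⟩
  obtain ⟨w⟩ := hG.1.nonempty
  have hB : ∃ b, b ∉ A := by
    by_cases hw : w ∈ A
    · obtain ⟨a, -, -, -, ⟨ha, -⟩, -⟩ := hdeg w
      exact ⟨a, hA.notMem ha hw⟩
    · exact ⟨w, hw⟩
  obtain ⟨b₀, hb₀⟩ := hB
  obtain ⟨l₀, c, c', hn₀, hl₀⟩ := hpriv b₀ hb₀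
  have hadj : ∀ b, b ∉ A → G.Adj b c ∧ G.Adj b c' := by
    intro b hb
    obtain ⟨l, p, q, hn, hl⟩ := hpriv b hb
    exact ⟨adj_of_private_neighbors hcard hA hdeg hb₀ hb hn₀ hn hl₀ hl,
      adj_of_private_neighbors hcard hA hdeg hb₀ hb (by rw [hn₀, Set.pair_comm]) hn hl₀ hl⟩
  have hcc' : c ≠ c' := by
    rintro rfl
    obtain ⟨p, q, r, -, ⟨hp, hq, hr⟩, hpq, hpr, hqr⟩ := hdeg b₀
    rw [← G.mem_neighborSet, hn₀] at hp hq hr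
    simp only [Set.mem_insert_iff, Set.mem_singleton_iff] at hp hq hr
    grind
  refine ⟨A, c, c', hA, hdeg, hA.mem (hadj b₀ hb₀).1 hb₀, hA.mem (hadj b₀ hb₀).2 hb₀, hcc',
    fun b hb => ?_⟩
  obtain ⟨x, y, z, hn⟩ := h3 b hb
  obtain ⟨h1, h2⟩ := hadj b hb
  have e : ∀ u, G.Adj b u ↔ u = x ∨ u = y ∨ u = z := fun u => by
    rw [← G.mem_neighborSet, hn]; simp
  obtain ⟨p, q, r, -, ⟨hp, hq, hr⟩, hpq, hpr, hqr⟩ := hdeg b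
  have : ∃ l, G.Adj b l ∧ l ≠ c ∧ l ≠ c' := by
    by_contra! h
    have i1 := h p hp
    have i2 := h q hq
    have i3 := h r hr
    grind
  obtain ⟨l, hl, hlc, hlc'⟩ := this
  refine ⟨l, hlc, hlc', Set.ext fun u => ?_⟩
  simp only [SimpleGraph.mem_neighborSet, Set.mem_insert_iff, Set.mem_singleton_iff]
  rw [e] at h1 h2 hl ⊢
  grind

/-! ### Star-like graphs are bipartite and perfect -/

namespace IsStarLike

variable {A : Finset V} {c c' : V}

theorem adj_iff (h : IsStarLike G A c c') {b : V} (hb : b ∉ A) :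
    ∃ l, l ≠ c ∧ l ≠ c' ∧ ∀ u, G.Adj b u ↔ u = c ∨ u = c' ∨ u = l := by
  obtain ⟨l, h1, h2, hn⟩ := h.neighborSet_eq b hb
  exact ⟨l, h1, h2, fun u => by rw [← G.mem_neighborSet, hn]; simp⟩

theorem adj_center (h : IsStarLike G A c c') {b : V} (hb : b ∉ A) : G.Adj b c := by
  obtain ⟨l, -, -, hl⟩ := h.adj_iff hb
  simp [hl]

theorem adj_twin (h : IsStarLike G A c c') {b : V} (hb : b ∉ A) : G.Adj b c' := by
  obtain ⟨l, -, -, hl⟩ := h.adj_iff hb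
  simp [hl]

theorem leaf_unique (h : IsStarLike G A c c') {b x y : V} (hb : b ∉ A) (bx : G.Adj b x)
    (hby : G.Adj b y) (hx : x ≠ c ∧ x ≠ c') (hy : y ≠ c ∧ y ≠ c') : x = y := by
  obtain ⟨l, -, -, hl⟩ := h.adj_iff hb
  rw [hl] at bx hby
  grind

theorem exists_notMem (h : IsStarLike G A c c') : ∃ b, b ∉ A := by
  obtain ⟨b, -, -, -, ⟨hb, -⟩, -⟩ := h.hasThree c
  exact ⟨b, h.isSide.notMem hb h.center_mem⟩

/-- Call the vertices of `A` other than `c`, `c'` leaves. No vertex dominates two of them, so a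
dominating set `D` with at most `|A| - 2` vertices contains exactly one dominator `f l` per leaf
`l`. Then `c` is dominated by some `f l` outside `A`, and a second neighbor `b` of `l` is
undominated: it is not in `D`, and neither are its neighbors `c`, `c'`, `l`. -/
theorem card_le_dominationNumber_add_one [Fintype V] (h : IsStarLike G A c c') :
    A.card ≤ dominationNumber G + 1 := by
  classical
  obtain ⟨D, hD, hDc⟩ := exists_card_eq_dominationNumber G
  by_contra! hlt
  have hcc : ({c, c'} : Finset V) ⊆ A := by
    intro x; simp only [Finset.mem_insert, Finset.mem_singleton]
    rintro (rfl | rfl)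
    exacts [h.center_mem, h.twin_mem]
  have hcard := Finset.card_sdiff_add_card_eq_card hcc
  rw [Finset.card_pair h.center_ne_twin] at hcard
  have hL : ∀ l, l ∈ A \ {c, c'} ↔ l ∈ A ∧ l ≠ c ∧ l ≠ c' := by simp
  have hf : ∀ l, ∃ d ∈ D, d = l ∨ G.Adj l d := by
    intro l
    by_cases hl : l ∈ D
    · exact ⟨l, hl, .inl rfl⟩
    · obtain ⟨d, hd, hld⟩ := hD l hl
      exact ⟨d, hd, .inr hld⟩
  choose f hfD hf using hf
  have hcase : ∀ l ∈ A \ {c, c'}, f l ∈ A ∧ f l = l ∨ f l ∉ A ∧ G.Adj (f l) l := by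
    intro l hl
    rcases hf l with h1 | h1
    · exact .inl ⟨by rw [h1]; exact ((hL l).1 hl).1, h1⟩
    · exact .inr ⟨h.isSide.notMem h1 ((hL l).1 hl).1, h1.symm⟩
  have hinj : Set.InjOn f (A \ {c, c'} : Finset V) := by
    intro l hl l' hl' heq
    rw [Finset.mem_coe] at hl hl'
    rcases hcase l hl with ⟨h1, h2⟩ | ⟨h1, h2⟩ <;> rcases hcase l' hl' with ⟨h3, h4⟩ | ⟨h3, h4⟩
    · rw [← h2, ← h4, heq]
    · exact absurd (heq ▸ h1) h3
    · exact absurd (heq ▸ h3) h1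
    · exact h.leaf_unique h1 h2 (heq ▸ h4) ((hL l).1 hl).2 ((hL l').1 hl').2
  have himg : (A \ {c, c'}).image f = D := by
    refine Finset.eq_of_subset_of_card_le (fun x hx => ?_) ?_
    · obtain ⟨l, -, rfl⟩ := Finset.mem_image.1 hx
      exact hfD l
    · rw [Finset.card_image_of_injOn hinj]
      omega
  have hDf : ∀ d ∈ D, ∃ l ∈ A \ {c, c'}, f l = d := fun d hd => by
    rw [← himg] at hd
    exact Finset.mem_image.1 hd
  have hDA : ∀ d ∈ D, d ∈ A → d ≠ c ∧ d ≠ c' ∧ f d = d := by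
    intro d hd hdA
    obtain ⟨l, hl, rfl⟩ := hDf d hd
    rcases hcase l hl with ⟨h1, h2⟩ | ⟨h1, -⟩
    · rw [h2]
      exact ⟨((hL l).1 hl).2.1, ((hL l).1 hl).2.2, h2⟩
    · exact absurd hdA h1
  obtain ⟨d, hd, hcd⟩ := hD c fun hc => (hDA c hc h.center_mem).1 rfl
  have hdA := h.isSide.notMem hcd h.center_mem
  obtain ⟨l, hl, rfl⟩ := hDf d hd
  have hdl : G.Adj (f l) l := by
    rcases hcase l hl with ⟨h1, -⟩ | ⟨-, h2⟩
    exacts [absurd h1 hdA, h2]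
  have hlA := (hL l).1 hl
  obtain ⟨b, hb, hbf⟩ : ∃ b, G.Adj l b ∧ b ≠ f l := by
    obtain ⟨x, y, -, -, ⟨hx, hy, -⟩, hxy, -⟩ := h.hasThree l
    by_cases hxf : x = f l
    · exact ⟨y, hy, fun hyf => hxy (hxf.trans hyf.symm)⟩
    · exact ⟨x, hx, hxf⟩
  have hbA := h.isSide.notMem hb hlA.1
  obtain ⟨u, hu, hbu⟩ := hD b (by
    intro hbD
    obtain ⟨l', hl', rfl⟩ := hDf b hbD
    rcases hcase l' hl' with ⟨h1, -⟩ | ⟨-, h2⟩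
    · exact hbA h1
    · exact hbf (by rw [h.leaf_unique hbA h2 hb.symm ((hL l').1 hl').2 hlA.2]))
  obtain ⟨h1, h2, h3⟩ := hDA u hu (h.isSide.mem hbu hbA)
  have hul := h.leaf_unique hbA hbu hb.symm ⟨h1, h2⟩ hlA.2
  subst hul
  exact hdA (h3.symm ▸ hlA.1)

theorem kDominationNumber_eq [Fintype V] (h : IsStarLike G A c c') :
    kDominationNumber G 3 = dominationNumber G + 1 := by
  classical
  refine le_antisymm
    ((kDominationNumber_le (h.isSide.isKDominating h.hasThree)).trans
      h.card_le_dominationNumber_add_one) ?_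
  obtain ⟨D, hD, hDc⟩ := exists_card_eq_kDominationNumber G 3
  by_cases hx : ∃ x, x ∉ D
  · obtain ⟨x, hx⟩ := hx
    rw [← hDc]
    exact dominationNumber_lt_card hD hx
  -- Here `D` is the whole vertex set, and the proper subset `A` contradicts its minimality.
  · push Not at hx
    obtain ⟨b, hb⟩ := h.exists_notMem
    have h1 : A.card < D.card :=
      Finset.card_lt_card (Finset.ssubset_iff.2 ⟨b, hb, fun x _ => hx x⟩)
    have h2 := kDominationNumber_le (h.isSide.isKDominating h.hasThree)
    omega

theorem connected (h : IsStarLike G A c c') : G.Connected := by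
  have key : ∀ v, G.Reachable v c := by
    intro v
    by_cases hv : v ∈ A
    · obtain ⟨b, -, -, -, ⟨hb, -⟩, -⟩ := h.hasThree v
      exact hb.reachable.trans (h.adj_center (h.isSide.notMem hb hv)).reachable
    · exact (h.adj_center hv).reachable
  exact (SimpleGraph.connected_iff G).2 ⟨fun u v => (key u).trans (key v).symm, ⟨c⟩⟩

theorem isBipartite (h : IsStarLike G A c c') : G.IsBipartite := by
  classical
  refine ⟨SimpleGraph.Coloring.mk (fun v => if v ∈ A then 0 else 1) fun {u v} huv => ?_⟩
  have := h.isSide u v huv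
  by_cases hu : u ∈ A <;> by_cases hv : v ∈ A <;> simp_all

/-- Vertices outside `A` have degree exactly three, so those in `S` keep all their neighbors,
including `c` and `c'`. -/
theorem induce [Fintype V] (h : IsStarLike G A c c') {S : Set V} (hS : S.Nonempty)
    (hdeg : ∀ v ∈ S, HasThreeNeighborsIn G S v) :
    ∃ (A' : Finset S) (d d' : S), IsStarLike (G.induce S) A' d d' := by
  classical
  have hsub : ∀ b ∈ S, b ∉ A → ∀ u, G.Adj b u → u ∈ S := by
    intro b hb hbA u hu
    obtain ⟨l, -, -, hl⟩ := h.adj_iff hbA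
    obtain ⟨p, q, r, ⟨hp, hq, hr⟩, ⟨bp, bq, br⟩, hne⟩ := hdeg b hb
    rw [hl] at bp bq br hu
    grind
  obtain ⟨v, hv⟩ := hS
  obtain ⟨b, hb, hbA⟩ : ∃ b ∈ S, b ∉ A := by
    by_cases hvA : v ∈ A
    · obtain ⟨b, -, -, ⟨hb, -⟩, ⟨hvb, -⟩, -⟩ := hdeg v hv
      exact ⟨b, hb, h.isSide.notMem hvb hvA⟩
    · exact ⟨v, hv, hvA⟩
  refine ⟨Finset.univ.filter fun v => v.1 ∈ A, ⟨c, hsub b hb hbA c (h.adj_center hbA)⟩,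
    ⟨c', hsub b hb hbA c' (h.adj_twin hbA)⟩, fun u v huv => ?_,
    fun v => (hasThreeNeighborsIn_induce_iff v.2).2 (hdeg v v.2), by simpa using h.center_mem,
    by simpa using h.twin_mem, by simpa using h.center_ne_twin, ?_⟩
  · simpa using h.isSide u v huv
  · rintro ⟨x, hx⟩ hxA
    simp only [Finset.mem_filter, Finset.mem_univ, true_and] at hxA
    obtain ⟨l, hlc, hlc', hl⟩ := h.adj_iff hxA
    refine ⟨⟨l, hsub x hx hxA l (by simp [hl])⟩, by simpa using hlc, by simpa using hlc',
      Set.ext fun ⟨u, hu⟩ => ?_⟩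
    simpa [Subtype.ext_iff] using hl u

theorem isGammaPerfect [Fintype V] (h : IsStarLike G A c c') : IsGammaPerfect G 3 := by
  classical
  have : Nonempty V := ⟨c⟩
  refine ⟨h.connected, ?_, fun S hS hdeg => ?_⟩
  · convert three_le_minDegree_iff.2 h.hasThree
  · have hne := hS.nonempty
    have hdeg' : ∀ v, HasThreeNeighborsIn (G.induce S) Set.univ v := by
      apply three_le_minDegree_iff.1
      convert hdeg
    obtain ⟨A', d, d', h'⟩ := h.induce (Set.nonempty_coe_sort.1 hne) fun v hv =>
      (hasThreeNeighborsIn_induce_iff hv).1 (hdeg' ⟨v, hv⟩)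
    have := h'.kDominationNumber_eq
    omega

theorem map {W : Type*} {H : SimpleGraph W} (e : G ≃g H) (h : IsStarLike G A c c') :
    IsStarLike H (A.map e.toEquiv.toEmbedding) (e c) (e c') := by
  have hadj : ∀ u v, H.Adj u v ↔ G.Adj (e.symm u) (e.symm v) := fun u v =>
    (e.symm.map_adj_iff).symm
  have hmem : ∀ u, u ∈ A.map e.toEquiv.toEmbedding ↔ e.symm u ∈ A := fun u =>
    Finset.mem_map_equiv
  refine ⟨fun u v huv => ?_, fun v => ?_, ?_, ?_, fun he => h.center_ne_twin (e.injective he),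
    fun b hb => ?_⟩
  · rw [hmem, hmem]
    exact h.isSide _ _ ((hadj u v).1 huv)
  · obtain ⟨x, y, z, -, ⟨hx, hy, hz⟩, hne⟩ := h.hasThree (e.symm v)
    refine ⟨e x, e y, e z, ⟨trivial, trivial, trivial⟩, ?_, by simpa using hne⟩
    simpa [hadj] using ⟨hx, hy, hz⟩
  · rw [hmem, e.symm_apply_apply]
    exact h.center_mem
  · rw [hmem, e.symm_apply_apply]
    exact h.twin_mem
  · rw [hmem] at hb
    obtain ⟨l, hlc, hlc', hl⟩ := h.adj_iff hb
    refine ⟨e l, by simpa using hlc, by simpa using hlc', Set.ext fun u => ?_⟩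
    have key : ∀ x, u = e x ↔ e.symm u = x := fun x =>
      ⟨fun h => by rw [h, e.symm_apply_apply], fun h => by rw [← h, e.apply_symm_apply]⟩
    simp only [SimpleGraph.mem_neighborSet, Set.mem_insert_iff, Set.mem_singleton_iff, key, hadj,
      hl]

end IsStarLike

/-! ### Star-like graphs are the members of the class -/

theorem starGraph_adj_subdiv {k r : ℕ} {i : Fin r → ℕ} (j : Fin r) (m : Fin (i j))
    (v : StarVertex k i) :
    (starGraph k i).Adj (.subdiv j m) v ↔ v = .center ∨ (∃ t, v = .twin t) ∨ v = .leaf j := by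
  constructor
  · rintro (h | h) <;> cases h
    · exact .inl rfl
    · exact .inr (.inr rfl)
    · exact .inr (.inl ⟨_, rfl⟩)
  · rintro (rfl | ⟨t, rfl⟩ | rfl)
    exacts [.inl (.toCenter j m), .inl (.toTwin j m t), .inl (.toLeaf j m)]

theorem starGraph_adj_or {k r : ℕ} {i : Fin r → ℕ} {u v : StarVertex k i}
    (h : (starGraph k i).Adj u v) : (∃ j m, u = .subdiv j m) ↔ ¬ ∃ j m, v = .subdiv j m := by
  rcases h with h | h <;> cases h <;> simp

theorem exists_isStarLike_starGraph {r : ℕ} (i : Fin r → ℕ) [Finite (StarVertex 3 i)] (hr : 1 ≤ r)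
    (hi : ∀ j, 3 ≤ i j) : ∃ A c c', IsStarLike (starGraph 3 i) A c c' := by
  classical
  have := Fintype.ofFinite (StarVertex 3 i)
  -- For `k = 3` the center has a single added twin.
  have ht : ∀ t : Fin (3 - 2), t = 0 := fun t => Fin.ext (by omega)
  have hmem : ∀ v, v ∈ Finset.univ.filter (fun v : StarVertex 3 i => ¬ ∃ j m, v = .subdiv j m) ↔
      ¬ ∃ j m, v = .subdiv j m := by simp
  have hthree : ∀ (j : Fin r) (v : StarVertex 3 i),
      (∀ m, (starGraph 3 i).Adj (.subdiv j m) v) →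
      HasThreeNeighborsIn (starGraph 3 i) Set.univ v := by
    intro j v h
    have := hi j
    refine ⟨.subdiv j ⟨0, by omega⟩, .subdiv j ⟨1, by omega⟩, .subdiv j ⟨2, by omega⟩,
      ⟨trivial, trivial, trivial⟩, ⟨(h _).symm, (h _).symm, (h _).symm⟩, ?_⟩
    simp
  refine ⟨Finset.univ.filter fun v => ¬ ∃ j m, v = .subdiv j m, .center, .twin 0,
    fun u v h => ?_, fun v => ?_, by simp, by simp, by simp, fun b hb => ?_⟩
  · rw [hmem, hmem]
    exact not_congr (starGraph_adj_or h)
  · cases v with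
    | center => exact hthree ⟨0, hr⟩ _ fun m => by simp [starGraph_adj_subdiv]
    | twin t => exact hthree ⟨0, hr⟩ _ fun m => by simp [starGraph_adj_subdiv]
    | leaf j => exact hthree j _ fun m => by simp [starGraph_adj_subdiv]
    | subdiv j m =>
      refine ⟨.center, .twin 0, .leaf j, ⟨trivial, trivial, trivial⟩, ?_, ?_⟩
      · simp [starGraph_adj_subdiv]
      · simp
  · rw [hmem, not_not] at hb
    obtain ⟨j, m, rfl⟩ := hb
    refine ⟨.leaf j, by simp, by simp, Set.ext fun u => ?_⟩
    rw [SimpleGraph.mem_neighborSet, starGraph_adj_subdiv]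
    simp only [Set.mem_insert_iff, Set.mem_singleton_iff]
    refine or_congr_right (or_congr_left ⟨?_, fun h => ⟨0, h⟩⟩)
    rintro ⟨t, rfl⟩
    rw [ht t]

theorem InStarClass.exists_isStarLike [Finite V] (h : InStarClass G 3) :
    ∃ A c c', IsStarLike G A c c' := by
  obtain ⟨r, i, hr, hi, ⟨e⟩⟩ := h
  have : Finite (StarVertex 3 i) := Finite.of_equiv V e.toEquiv
  obtain ⟨A, c, c', h⟩ := exists_isStarLike_starGraph i hr hi
  exact ⟨_, _, _, h.map e.symm⟩

/-- Each vertex outside `A` sees exactly one vertex of `A` besides `c` and `c'`, so the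
neighborhoods of these leaves partition the other side into the bundles, and `i j` is the degree of
the `j`-th leaf. -/
theorem IsStarLike.inStarClass [Fintype V] {A : Finset V} {c c' : V} (h : IsStarLike G A c c') :
    InStarClass G 3 := by
  classical
  obtain ⟨r, ⟨eL⟩⟩ : ∃ r, Nonempty (Fin r ≃ {l : V // l ∈ A ∧ l ≠ c ∧ l ≠ c'}) :=
    ⟨_, ⟨(Fintype.equivFin _).symm⟩⟩
  obtain ⟨i, ⟨eB⟩⟩ : ∃ i : Fin r → ℕ, Nonempty (∀ j, Fin (i j) ≃ G.neighborSet (eL j).1) :=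
    ⟨_, ⟨fun _ => (Fintype.equivFin _).symm⟩⟩
  have hB : ∀ j m, (eB j m).1 ∉ A := fun j m => h.isSide.notMem (eB j m).2 (eL j).2.1
  obtain ⟨f, hc, ht, hl, hs⟩ : ∃ f : StarVertex 3 i → V, f .center = c ∧ (∀ t, f (.twin t) = c') ∧
      (∀ j, f (.leaf j) = (eL j).1) ∧ ∀ j m, f (.subdiv j m) = (eB j m).1 :=
    ⟨fun
      | .center => c
      | .twin _ => c'
      | .leaf j => (eL j).1
      | .subdiv j m => (eB j m).1, rfl, fun _ => rfl, fun _ => rfl, fun _ _ => rfl⟩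
  have hfA : ∀ v, f v ∈ A ↔ ¬ ∃ j m, v = .subdiv j m := by
    intro v
    cases v with
    | center => simpa [hc] using h.center_mem
    | twin t => simpa [ht] using h.twin_mem
    | leaf j => simpa [hl] using (eL j).2.1
    | subdiv j m => simpa [hs] using hB j m
  have hleaf : ∀ j m j', G.Adj (eB j m).1 (eL j').1 ↔ j' = j := by
    intro j m j'
    constructor
    · intro hadj
      have := h.leaf_unique (hB j m) hadj (G.adj_symm (eB j m).2) (eL j').2.2 (eL j).2.2
      exact eL.injective (Subtype.ext this)
    · rintro rfl
      exact G.adj_symm (eB j' m).2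
  have hadj_subdiv : ∀ j m v, G.Adj (f (.subdiv j m)) (f v) ↔
      (starGraph 3 i).Adj (.subdiv j m) v := by
    intro j m v
    rw [starGraph_adj_subdiv, hs]
    cases v with
    | center => simpa [hc] using h.adj_center (hB j m)
    | twin t => simpa [ht] using h.adj_twin (hB j m)
    | leaf j' => simpa [hl] using hleaf j m j'
    | subdiv j' m' =>
      rw [hs]
      simpa using fun hadj => hB j' m' (h.isSide.mem hadj (hB j m))
  have hadj : ∀ u v, G.Adj (f u) (f v) ↔ (starGraph 3 i).Adj u v := by
    intro u v
    by_cases hu : ∃ j m, u = .subdiv j m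
    · obtain ⟨j, m, rfl⟩ := hu
      exact hadj_subdiv j m v
    by_cases hv : ∃ j m, v = .subdiv j m
    · obtain ⟨j, m, rfl⟩ := hv
      rw [G.adj_comm, (starGraph 3 i).adj_comm]
      exact hadj_subdiv j m u
    · refine ⟨fun huv => ?_, fun huv => ?_⟩
      · exact absurd ((hfA v).2 hv) (h.isSide.notMem huv ((hfA u).2 hu))
      · exact absurd ((starGraph_adj_or huv).2 hv) hu
  have hinj : Function.Injective f := by
    intro u v huv
    have hiff := (hfA u).symm.trans ((by rw [huv] : f u ∈ A ↔ f v ∈ A).trans (hfA v))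
    have hcL := fun j => (eL j).2.2.1
    have hcL' := fun j => (eL j).2.2.2
    cases u with
    | center =>
      cases v with
      | center => rfl
      | twin t => rw [hc, ht] at huv; exact absurd huv h.center_ne_twin
      | leaf j => rw [hc, hl] at huv; exact absurd huv.symm (hcL j)
      | subdiv j m => simp at hiff
    | twin t =>
      cases v with
      | center => rw [hc, ht] at huv; exact absurd huv.symm h.center_ne_twin
      | twin t' => rw [show t = t' from Fin.ext (by omega)]
      | leaf j => rw [ht, hl] at huv; exact absurd huv.symm (hcL' j)
      | subdiv j m => simp at hiff
    | leaf j =>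
      cases v with
      | center => rw [hc, hl] at huv; exact absurd huv (hcL j)
      | twin t => rw [ht, hl] at huv; exact absurd huv (hcL' j)
      | leaf j' =>
        rw [hl, hl] at huv
        rw [eL.injective (Subtype.ext huv)]
      | subdiv j' m => simp at hiff
    | subdiv j m =>
      cases v with
      | center => simp at hiff
      | twin t => simp at hiff
      | leaf j' => simp at hiff
      | subdiv j' m' =>
        rw [hs, hs] at huv
        obtain rfl : j' = j := (hleaf j m j').1 (by rw [huv]; exact G.adj_symm (eB j' m').2)
        rw [(eB j').injective (Subtype.ext huv)]
  have hadjL : ∀ b ∉ A, ∃ j, G.Adj (eL j).1 b := by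
    intro b hb
    obtain ⟨l, hlc, hlc', hn⟩ := h.adj_iff hb
    have hbl : G.Adj b l := by simp [hn]
    refine ⟨eL.symm ⟨l, h.isSide.mem hbl hb, hlc, hlc'⟩, ?_⟩
    rw [eL.apply_symm_apply]
    exact hbl.symm
  have hsurj : Function.Surjective f := by
    intro v
    by_cases hv : v ∈ A
    · by_cases hvc : v = c
      · exact ⟨.center, hc.trans hvc.symm⟩
      by_cases hvc' : v = c'
      · exact ⟨.twin 0, (ht 0).trans hvc'.symm⟩
      refine ⟨.leaf (eL.symm ⟨v, hv, hvc, hvc'⟩), ?_⟩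
      rw [hl, eL.apply_symm_apply]
    · obtain ⟨j, hj⟩ := hadjL v hv
      refine ⟨.subdiv j ((eB j).symm ⟨v, hj⟩), ?_⟩
      rw [hs, (eB j).apply_symm_apply]
  let e : starGraph 3 i ≃g G := ⟨Equiv.ofBijective f ⟨hinj, hsurj⟩, hadj _ _⟩
  -- A vertex outside `A` has a leaf, which gives `r ≥ 1`.
  obtain ⟨b, hb⟩ := h.exists_notMem
  obtain ⟨j₀, -⟩ := hadjL b hb
  refine ⟨_, i, by have := j₀.2; omega, fun j => ?_, ⟨e.symm⟩⟩
  have := (three_le_degree_iff (eL j).1).2 (h.hasThree (eL j).1)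
  rwa [← G.card_neighborSet_eq_degree, ← Fintype.card_congr (eB j), Fintype.card_fin] at this

end PerfectDomination

theorem mainTheorem2 {V : Type*} [Fintype V] (G : SimpleGraph V) :
    (G.IsBipartite ∧ PerfectDomination.IsGammaPerfect G 3) ↔
      PerfectDomination.InStarClass G 3 := by
  constructor
  · rintro ⟨hb, hG⟩
    obtain ⟨A, c, c', h⟩ := PerfectDomination.exists_isStarLike hb hG
    exact h.inStarClass
  · intro h
    obtain ⟨A, c, c', h⟩ := h.exists_isStarLike
    exact ⟨h.isBipartite, h.isGammaPerfect⟩
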